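/- Let $R$ be an associative ring with unity; all modules are unital right $R$-modules. An essential embedding is an injective homomorphism $f:N\to M$ whose image meets every nonzero submodule of $M$ nontrivially. A nonzero module is indecomposable if it is not the direct sum of two nonzero submodules; a module is uniform if each of its nonzero submodules meets every nonzero submodule nontrivially. Write $E(M)$ for the injective hull of $M$. A module $M$ is called roughly $N$-tight if, for every proper submodule $K\subsetneq N$ such that $N/K$ embeds in $E(M)$, there is an essential embedding of $N/K$ into $M$. The ring $R$ is called CEP if every cyclic $R$-module has an essential embedding into some projective $R$-module. Theorem. The ring $R$ is CEP if and only if 1. $R$ is (right) artinian, and 2. every indecomposable projective $R$-module is uniform and roughly $R$-tight (that is, roughly $N$-tight for $N=R_R$). -/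

import Mathlib

/-!
Module-theoretic notions.  Everything is developed for (left) modules over a ring `A`; right modules
over a ring `R` are, as everywhere in Mathlib, modules over the opposite ring `Rᵐᵒᵖ`.
-/

universe u

namespace EssMod

section
variable (A : Type u) [Ring A]

/-- A submodule `K` of `M` is essential if it meets every nonzero submodule of `M` nontrivially. -/
def IsEssential {A : Type u} [Ring A] {M : Type u} [AddCommGroup M] [Module A M]
    (K : Submodule A M) : Prop :=
  ∀ B : Submodule A M, K ⊓ B = ⊥ → B = ⊥

/-- An essential embedding: an injective linear map whose image is an essential submodule. -/
def IsEssentialEmbedding {A : Type u} [Ring A] {M N : Type u} [AddCommGroup M] [Module A M]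
    [AddCommGroup N] [Module A N] (f : M →ₗ[A] N) : Prop :=
  Function.Injective f ∧ IsEssential (LinearMap.range f)

/-- `N` embeds in `M`. -/
def Embeds (N M : Type u) [AddCommGroup N] [Module A N] [AddCommGroup M] [Module A M] : Prop :=
  ∃ f : N →ₗ[A] M, Function.Injective f

/-- `N` essentially embeds in `M`. -/
def EssentiallyEmbeds (N M : Type u) [AddCommGroup N] [Module A N]
    [AddCommGroup M] [Module A M] : Prop :=
  ∃ f : N →ₗ[A] M, IsEssentialEmbedding f

/-- `ι : M → E` exhibits `E` as an injective hull `E(M)` of `M`: `E` is an injective module and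
`ι` is an essential embedding. -/
def IsInjectiveHull {A : Type u} [Ring A] {M E : Type u} [AddCommGroup M] [Module A M]
    [AddCommGroup E] [Module A E] (ι : M →ₗ[A] E) : Prop :=
  Module.Injective A E ∧ IsEssentialEmbedding ι

/-- A module is uniform if each of its nonzero submodules is essential. -/
def IsUniform (M : Type u) [AddCommGroup M] [Module A M] : Prop :=
  ∀ K : Submodule A M, K ≠ ⊥ → IsEssential K

/-- A module is indecomposable if it is nonzero and is not the internal direct sum of two nonzero
submodules. -/
def IsIndecomposable (M : Type u) [AddCommGroup M] [Module A M] : Prop :=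
  Nontrivial M ∧ ∀ K L : Submodule A M, IsCompl K L → K = ⊥ ∨ L = ⊥

/-- A module is cyclic if it is generated by one element. -/
def IsCyclicModule (M : Type u) [AddCommGroup M] [Module A M] : Prop :=
  ∃ x : M, Submodule.span A {x} = ⊤

/-- `M` is roughly `N`-tight: for every proper submodule `K` of `N`, if `N ⧸ K` embeds in the
injective hull of `M`, then `N ⧸ K` essentially embeds in `M`.  (The injective hull exists, see
`exists_isInjectiveHull`, and is unique up to isomorphism.) -/
def IsRoughlyTight (N M : Type u) [AddCommGroup N] [Module A N]
    [AddCommGroup M] [Module A M] : Prop :=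
  ∀ K : Submodule A N, K ≠ ⊤ →
    ∀ (E : Type u) [AddCommGroup E] [Module A E] (ι : M →ₗ[A] E), IsInjectiveHull ι →
      Embeds A (N ⧸ K) E → EssentiallyEmbeds A (N ⧸ K) M

/-- Every module has an injective hull. -/
theorem exists_isInjectiveHull (M : Type u) [AddCommGroup M] [Module A M] :
    ∃ (E : Type u) (_ : AddCommGroup E) (_ : Module A E) (ι : M →ₗ[A] E), IsInjectiveHull ι := by
  obtain ⟨⟨I, hI, j, hj⟩⟩ := CategoryTheory.EnoughInjectives.presentation (ModuleCat.of A M)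
  have hI' : Module.Injective A I := by
    have : CategoryTheory.Injective (ModuleCat.of A I) := hI
    exact Module.injective_module_of_injective_object A I
  have hj' : Function.Injective j.hom := (ModuleCat.mono_iff_injective j).mp hj
  obtain ⟨J, hJ⟩ : ∃ J : M →ₗ[A] I, Function.Injective J := ⟨j.hom, hj'⟩
  obtain ⟨E, hE0, hEmax⟩ := zorn_le_nonempty₀
    {F : Submodule A I | LinearMap.range J ≤ F ∧
      ∀ B ≤ F, LinearMap.range J ⊓ B = ⊥ → B = ⊥}
    (by
      intro c hc hchain y hy
      have hdir : DirectedOn (· ≤ ·) c := hchain.directedOn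
      refine ⟨sSup c, ⟨(hc hy).1.trans (le_sSup hy), ?_⟩, fun z hz => le_sSup hz⟩
      intro B hB hd
      rw [eq_bot_iff]
      intro b hb
      obtain ⟨F, hF, hbF⟩ := (Submodule.mem_sSup_of_directed ⟨y, hy⟩ hdir).1 (hB hb)
      have h1 : Submodule.span A {b} = ⊥ := by
        refine (hc hF).2 _ ((Submodule.span_singleton_le_iff_mem _ _).2 hbF) ?_
        rw [eq_bot_iff, ← hd]
        exact inf_le_inf_left _ ((Submodule.span_singleton_le_iff_mem _ _).2 hb)
      have := Submodule.mem_span_singleton_self (R := A) b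
      rwa [h1] at this)
    (LinearMap.range J) ⟨le_rfl, fun B hB h => by rwa [inf_eq_right.2 hB] at h⟩
  obtain ⟨C, -, hC⟩ := zorn_le_nonempty₀ {F : Submodule A I | E ⊓ F = ⊥}
    (by
      intro c hc hchain y hy
      have hdir : DirectedOn (· ≤ ·) c := hchain.directedOn
      refine ⟨sSup c, ?_, fun z hz => le_sSup hz⟩
      change E ⊓ sSup c = ⊥
      rw [eq_bot_iff]
      rintro b ⟨hbE, hb⟩
      obtain ⟨F, hF, hbF⟩ := (Submodule.mem_sSup_of_directed ⟨y, hy⟩ hdir).1 hb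
      have h2 : E ⊓ F = ⊥ := hc hF
      rw [← h2]
      exact ⟨hbE, hbF⟩)
    ⊥ (by simp)
  have hCE : E ⊓ C = ⊥ := hC.1
  obtain ⟨h, hh⟩ := hI'.out (C.mkQ ∘ₗ E.subtype)
    (by
      rw [← LinearMap.ker_eq_bot, eq_bot_iff]
      intro x hx
      have hxC : (x : I) ∈ C := by simpa using hx
      have : (x : I) ∈ E ⊓ C := ⟨x.2, hxC⟩
      rw [hCE] at this
      simpa using this) E.subtype
  obtain ⟨p, hpE, hpC⟩ : ∃ p : I →ₗ[A] I, (∀ x ∈ E, p x = x) ∧ ∀ x ∈ C, p x = 0 :=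
    ⟨h ∘ₗ C.mkQ, fun x hx => hh ⟨x, hx⟩, fun x hx => by
      simp [(Submodule.Quotient.mk_eq_zero C).2 hx]⟩
  have hEp : E ≤ LinearMap.range p := fun x hx => ⟨x, hpE x hx⟩
  have hess : ∀ B ≤ LinearMap.range p, E ⊓ B = ⊥ → B = ⊥ := by
    intro B hB hd
    have h1 : B.comap p ≤ C := by
      refine hC.2 (y := B.comap p) ?_ ?_
      · change E ⊓ B.comap p = ⊥
        rw [eq_bot_iff, ← hd]
        rintro x ⟨hx, hxB⟩
        refine ⟨hx, ?_⟩
        have : p x ∈ B := hxB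
        rwa [hpE x hx] at this
      · intro x hx
        simp [hpC x hx]
    rw [eq_bot_iff]
    intro b hb
    obtain ⟨x, rfl⟩ := hB hb
    simp [hpC x (h1 hb)]
  have hrange : LinearMap.range p ≤ E := by
    refine hEmax.2 (y := LinearMap.range p) ⟨hE0.trans hEp, ?_⟩ hEp
    intro B hB hd
    refine hess B hB (hEmax.1.2 _ inf_le_left ?_)
    rw [eq_bot_iff, ← hd]
    exact inf_le_inf_left _ inf_le_right
  refine ⟨E, inferInstance, inferInstance,
    J.codRestrict E (fun x => hE0 ⟨x, rfl⟩), ⟨⟨?_⟩, ?_, ?_⟩⟩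
  · intro X Y _ _ _ _ f hf g
    obtain ⟨k, hk⟩ := hI'.out f hf (E.subtype ∘ₗ g)
    refine ⟨(p ∘ₗ k).codRestrict E (fun x => hrange ⟨k x, rfl⟩), fun x => ?_⟩
    apply Subtype.ext
    simp [hk, hpE]
  · intro x y hxy
    exact hJ (congrArg Subtype.val hxy)
  · intro B hB
    have h1 : B.map E.subtype = ⊥ := by
      refine hEmax.1.2 _ (Submodule.map_subtype_le _ _) ?_
      rw [eq_bot_iff]
      rintro x ⟨⟨m, rfl⟩, y, hy, hyx⟩
      have h2 : y ∈ LinearMap.range (J.codRestrict E (fun x => hE0 ⟨x, rfl⟩)) ⊓ B :=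
        ⟨⟨m, Subtype.ext hyx.symm⟩, hy⟩
      rw [hB] at h2
      have h3 : y = 0 := by simpa using h2
      rw [← hyx, h3]
      simp
    rw [eq_bot_iff]
    intro y hy
    have h4 : (y : I) ∈ B.map E.subtype := ⟨y, hy, rfl⟩
    rw [h1] at h4
    simpa using h4

end

section
variable (R : Type u) [Ring R]

/-- `R` is a (right) CEP ring: every cyclic right `R`-module essentially embeds in a projective
right `R`-module. -/
def IsCEPRing : Prop :=
  ∀ (N : Type u) [AddCommGroup N] [Module Rᵐᵒᵖ N], IsCyclicModule Rᵐᵒᵖ N →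
    ∃ (P : Type u) (_ : AddCommGroup P) (_ : Module Rᵐᵒᵖ P),
      Module.Projective Rᵐᵒᵖ P ∧ EssentiallyEmbeds Rᵐᵒᵖ N P

end

end EssMod

namespace EssMod

/-! ### Essential submodules and singular closures. -/

section Essential

variable {A : Type u} [Ring A] {M N L : Type u} [AddCommGroup M] [Module A M] [AddCommGroup N]
  [Module A N] [AddCommGroup L] [Module A L]

theorem isEssential_iff {K : Submodule A M} :
    IsEssential K ↔ ∀ x : M, x ≠ 0 → ∃ a : A, a • x ≠ 0 ∧ a • x ∈ K := by
  constructor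
  · intro h x hx
    by_contra! hc
    have := h (Submodule.span A {x}) (by
      rw [eq_bot_iff]
      rintro y ⟨hyK, hy⟩
      obtain ⟨a, rfl⟩ := Submodule.mem_span_singleton.1 hy
      by_contra h0
      exact hc a h0 hyK)
    exact hx (Submodule.span_singleton_eq_bot.1 this)
  · intro h B hB
    rw [eq_bot_iff]
    intro x hx
    by_contra h0
    obtain ⟨a, ha, haK⟩ := h x h0
    have : a • x ∈ K ⊓ B := ⟨haK, B.smul_mem a hx⟩
    rw [hB] at this
    exact ha this

theorem IsEssential.mono {K K' : Submodule A M} (h : IsEssential K) (hle : K ≤ K') :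
    IsEssential K' := fun B hB => h B (eq_bot_iff.2 (hB ▸ inf_le_inf_right B hle))

theorem IsEssential.inf {K K' : Submodule A M} (h : IsEssential K) (h' : IsEssential K') :
    IsEssential (K ⊓ K') := fun B hB => h' B (h _ (by rw [← inf_assoc, hB]))

theorem isEssential_top : IsEssential (⊤ : Submodule A M) := fun B hB => by
  rwa [top_inf_eq] at hB

theorem IsEssential.comap {K : Submodule A N} (h : IsEssential K) (f : M →ₗ[A] N) :
    IsEssential (K.comap f) := by
  rw [isEssential_iff] at h ⊢
  intro x hx
  by_cases h0 : f x = 0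
  · exact ⟨1, by simpa using hx, by simp [h0]⟩
  · obtain ⟨a, ha, haK⟩ := h _ h0
    exact ⟨a, fun h1 => ha (by rw [← map_smul, h1, map_zero]), by simpa using haK⟩

theorem IsEssential.finset_inf {ι : Type*} (s : Finset ι) {K : ι → Submodule A M}
    (h : ∀ i ∈ s, IsEssential (K i)) : IsEssential (s.inf K) := by
  classical
  induction s using Finset.induction_on with
  | empty => exact isEssential_top
  | insert i s _ ih =>
    rw [Finset.inf_insert]
    exact (h i (by simp)).inf (ih fun j hj => h j (by simp [hj]))

theorem IsEssential.map {K : Submodule A M} (hK : IsEssential K) {f : M →ₗ[A] N}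
    (hf : IsEssentialEmbedding f) : IsEssential (K.map f) := by
  have h2 := isEssential_iff.1 hf.2
  rw [isEssential_iff] at hK ⊢
  intro y hy
  obtain ⟨a, ha, x, hx⟩ := h2 y hy
  obtain ⟨b, hb, hbK⟩ := hK x (by rintro rfl; exact ha (by rw [← hx, map_zero]))
  have hba : (b * a) • y = f (b • x) := by rw [mul_smul, ← hx, map_smul]
  refine ⟨b * a, ?_, ?_⟩
  · rw [hba]
    exact fun h0 => hb (hf.1 (by rw [h0, map_zero]))
  · rw [hba]
    exact ⟨_, hbK, rfl⟩

theorem IsEssentialEmbedding.comp {g : N →ₗ[A] L} {f : M →ₗ[A] N} (hg : IsEssentialEmbedding g)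
    (hf : IsEssentialEmbedding f) : IsEssentialEmbedding (g ∘ₗ f) :=
  ⟨hg.1.comp hf.1, by rw [LinearMap.range_comp]; exact hf.2.map hg⟩

theorem isEssentialEmbedding_equiv (e : M ≃ₗ[A] N) : IsEssentialEmbedding (e : M →ₗ[A] N) :=
  ⟨e.injective, by rw [LinearEquiv.range]; exact isEssential_top⟩

/-- A linear map which is injective on an essential submodule is injective. -/
theorem IsEssential.injective {K : Submodule A M} (hK : IsEssential K) {f : M →ₗ[A] N}
    (h : K ⊓ LinearMap.ker f = ⊥) : Function.Injective f :=
  LinearMap.ker_eq_bot.1 (hK _ h)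

theorem IsUniform.of_injective (hN : IsUniform A N) {f : M →ₗ[A] N}
    (hf : Function.Injective f) : IsUniform A M := by
  intro K hK B hKB
  have h1 : K.map f ≠ ⊥ := fun h => hK (Submodule.map_injective_of_injective hf (by rw [h, Submodule.map_bot]))
  refine Submodule.map_injective_of_injective hf ?_
  rw [Submodule.map_bot]
  refine hN _ h1 (B.map f) ?_
  rw [← Submodule.map_inf _ hf, hKB, Submodule.map_bot]

theorem IsUniform.of_isEssentialEmbedding (hM : IsUniform A M) {f : M →ₗ[A] N}
    (hf : IsEssentialEmbedding f) : IsUniform A N := by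
  intro K hK
  have h1 : K.comap f ≠ ⊥ := by
    intro h
    refine hK (hf.2 _ ?_)
    rw [← Submodule.map_comap_eq, h, Submodule.map_bot]
  exact ((hM _ h1).map hf).mono (Submodule.map_comap_le f K)

theorem IsUniform.isIndecomposable [Nontrivial M] (hM : IsUniform A M) :
    IsIndecomposable A M := by
  refine ⟨inferInstance, fun K L h => ?_⟩
  by_contra! hc
  exact hc.2 (hM K hc.1 L h.inf_eq_bot)

/-- The elements of `M` which are carried into `K` by an essential left ideal. -/
def singularOver (K : Submodule A M) : Submodule A M where
  carrier := {x | IsEssential (K.comap (LinearMap.toSpanSingleton A M x))}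
  zero_mem' := by
    refine isEssential_top.mono ?_
    intro a _
    simp
  add_mem' := by
    intro x y hx hy
    refine (hx.inf hy).mono ?_
    rintro a ⟨h1, h2⟩
    simpa using K.add_mem h1 h2
  smul_mem' := by
    intro b x hx
    refine (hx.comap (LinearMap.toSpanSingleton A A b)).mono ?_
    intro a ha
    simpa [mul_smul] using ha

theorem mem_singularOver {K : Submodule A M} {x : M} :
    x ∈ singularOver K ↔ IsEssential (K.comap (LinearMap.toSpanSingleton A M x)) := Iff.rfl

theorem singularOver_mono {K K' : Submodule A M} (h : K ≤ K') :
    singularOver K ≤ singularOver K' := fun _ hx =>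
  IsEssential.mono (mem_singularOver.1 hx) (Submodule.comap_mono h)

theorem IsEssential.singularOver_eq_top {K : Submodule A M} (h : IsEssential K) :
    singularOver K = ⊤ := eq_top_iff.2 fun _ _ => h.comap _

theorem map_singularOver_le {K : Submodule A M} (f : M →ₗ[A] N) :
    (singularOver K).map f ≤ singularOver (K.map f) := by
  rintro _ ⟨x, hx, rfl⟩
  refine IsEssential.mono (mem_singularOver.1 hx) ?_
  intro a ha
  exact ⟨_, ha, by simp⟩

/-- A linear map sending an essential submodule into `K` has values in `singularOver K`. -/
theorem IsEssential.range_le_singularOver {U : Submodule A M} (hU : IsEssential U)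
    {f : M →ₗ[A] N} {K : Submodule A N} (h : U.map f ≤ K) :
    LinearMap.range f ≤ singularOver K := by
  rw [LinearMap.range_eq_map, ← hU.singularOver_eq_top]
  exact (map_singularOver_le f).trans (singularOver_mono h)

/-- A projective module with an essential cyclic submodule has a maximal submodule above the
singular closures of any directed family of nonessential submodules. -/
theorem exists_isCoatom_of_directed {P : Type u} [AddCommGroup P] [Module A P]
    [Module.Projective A P] {x : P} (hx : IsEssential (Submodule.span A {x}))
    {ι : Type*} [Nonempty ι] {σ : ι → Submodule A P} (hdir : Directed (· ≤ ·) σ)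
    (hσ : ∀ i, ¬ IsEssential (σ i)) :
    ∃ M : Submodule A P, IsCoatom M ∧ ∀ i, singularOver (σ i) ≤ M := by
  classical
  obtain ⟨s, hs⟩ := Module.projective_def'.1 (inferInstance : Module.Projective A P)
  have hsum : ∀ y : P, y = ∑ p ∈ (s y).support, s y p • p := fun y => by
    have := LinearMap.congr_fun hs y
    rw [LinearMap.comp_apply, Finsupp.linearCombination_apply] at this
    exact this.symm
  have hdir' : Directed (· ≤ ·) fun i => singularOver (σ i) :=
    hdir.mono_comp _ fun _ _ h => singularOver_mono h
  set T : Submodule A P := ⨆ i, singularOver (σ i) with hT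
  have hTmem : ∀ {y}, y ∈ T ↔ ∃ i, y ∈ singularOver (σ i) := fun {y} =>
    Submodule.mem_iSup_of_directed _ hdir'
  set F := (s x).support with hF
  -- A coordinate outside `F` kills `x`, hence an essential submodule, so its values are singular
  -- over every submodule.
  have hoff : ∀ p ∉ F, ∀ y : P, s y p • p ∈ T := by
    intro p hp y
    obtain ⟨i⟩ := ‹Nonempty ι›
    refine hTmem.2 ⟨i, ?_⟩
    let φ : P →ₗ[A] P := (LinearMap.toSpanSingleton A P p) ∘ₗ (Finsupp.lapply p) ∘ₗ s
    refine hx.range_le_singularOver (f := φ) ?_ ⟨y, by simp [φ]⟩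
    rw [Submodule.map_span_le]
    intro z hz
    rw [Set.mem_singleton_iff.1 hz]
    have : s x p = 0 := by simpa [hF] using hp
    simp [φ, this]
  -- Otherwise one index `j` serves all of the finite set `F`. The multiples of `x` whose
  -- coordinates carry each `p ∈ F` into `σ j` form an essential submodule inside `σ j`.
  have hTF : ¬ ∀ p ∈ F, p ∈ T := by
    intro h
    choose! c hc using fun p hp => hTmem.1 (h p hp)
    obtain ⟨j, hj⟩ := hdir.finset_le (F.image c)
    apply hσ j
    have hess : ∀ p ∈ F, IsEssential (((σ j).comap (LinearMap.toSpanSingleton A P p)).comap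
        ((Finsupp.lapply p) ∘ₗ s)) := fun p hp =>
      IsEssential.comap (singularOver_mono (hj _ (Finset.mem_image_of_mem c hp)) (hc p hp)) _
    refine (hx.inf (IsEssential.finset_inf F hess)).mono ?_
    rintro y ⟨hy, hyF⟩
    rw [SetLike.mem_coe, Submodule.mem_finsetInf] at hyF
    obtain ⟨a, rfl⟩ := Submodule.mem_span_singleton.1 hy
    rw [hsum (a • x)]
    refine Submodule.sum_mem _ fun p hp => ?_
    have hpF : p ∈ F := by
      rw [hF, Finsupp.mem_support_iff]
      rw [Finsupp.mem_support_iff] at hp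
      intro h0
      exact hp (by simp [h0])
    simpa using hyF p hpF
  push Not at hTF
  obtain ⟨p₀, hp₀, hp₀T⟩ := hTF
  have hgen : Submodule.span A (F : Set P) ⊔ T = ⊤ := by
    rw [eq_top_iff]
    intro y _
    rw [hsum y]
    refine Submodule.sum_mem _ fun p _ => ?_
    by_cases hp : p ∈ F
    · exact Submodule.mem_sup_left (Submodule.smul_mem _ _ (Submodule.subset_span hp))
    · exact Submodule.mem_sup_right (hoff p hp y)
  have hfin : Module.Finite A (P ⧸ T) := by
    refine ⟨⟨F.image T.mkQ, ?_⟩⟩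
    rw [Finset.coe_image, Submodule.span_image, eq_top_iff, ← Submodule.range_mkQ T,
      LinearMap.range_eq_map, ← hgen, Submodule.map_sup]
    simp
  have hnt : Nontrivial (P ⧸ T) := by
    rw [Submodule.Quotient.nontrivial_iff]
    rintro h
    exact hp₀T (h ▸ Submodule.mem_top)
  obtain ⟨M', hM', -⟩ := (eq_top_or_exists_le_coatom (⊥ : Submodule A (P ⧸ T))).resolve_left
    bot_ne_top
  refine ⟨M'.comap T.mkQ, ?_, fun i y hy => ?_⟩
  · exact (Submodule.isCoatom_comap_iff (Submodule.mkQ_surjective T)).2 hM'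
  · have : T.mkQ y = 0 := by simpa using hTmem.2 ⟨i, hy⟩
    simp [this]

end Essential

/-! ### A diagonal argument on almost disjoint sets. -/

section AlmostDisjoint

open Cardinal

/-- A diagonal argument: an infinite set has a family of unbounded subsets such that any colouring
of the family by the set itself has two members of the same colour with bounded intersection. -/
theorem exists_almostDisjoint_family (Ω : Type u) [Infinite Ω] :
    ∃ (I : Type u) (U : (I → I) → Set Ω) (B : I → Set Ω), Nonempty I ∧ Directed (· ≤ ·) B ∧
      (∀ f j, ¬ U f ⊆ B j) ∧
      ∀ F : (I → I) → Ω, ∃ f g j, F f = F g ∧ U f ∩ U g ⊆ B j := by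
  classical
  -- `I` is an initial ordinal, so its proper initial segments are smaller than `I`. With `Ω` viewed
  -- as `I × I`, the sets `U f` are graphs of functions and the sets `B j` are the strips over
  -- initial segments.
  let I : Type u := (#Ω).ord.ToType
  have hI : #I = #Ω := mk_ord_toType _
  have hInf : ℵ₀ ≤ #Ω := aleph0_le_mk Ω
  have : NoMaxOrder I := noMaxOrder hInf
  obtain ⟨c⟩ : Nonempty (Ω ≃ I) := Cardinal.eq.1 hI.symm
  obtain ⟨e⟩ : Nonempty (I × I ≃ Ω) := Cardinal.eq.1 (by
    rw [mk_prod, lift_id, hI]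
    exact mul_eq_self hInf)
  have hIio : ∀ i : I, #(Set.Iio i) < #I := fun i => mk_Iio_lt i (by
    rw [Ordinal.type_toType, hI])
  refine ⟨I, fun f => Set.range fun a => e (a, f a), fun j => e '' {p | p.1 ≤ j},
    ⟨c (Classical.arbitrary Ω)⟩, ?_, ?_, ?_⟩
  · refine Monotone.directed_le fun i j hij => ?_
    exact Set.image_mono fun p (hp : p.1 ≤ i) => hp.trans hij
  · intro f j h
    obtain ⟨a, ha⟩ := exists_gt j
    obtain ⟨p, hp, hpe⟩ := h ⟨a, rfl⟩
    have := e.injective hpe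
    subst this
    exact absurd ha (not_lt.2 hp)
  · intro F
    -- `r i` is a chosen function of colour `i`. The diagonal function `g` differs at `a` from every
    -- `r i` with `i < a`, so it agrees with the representative of its own colour only on a bounded
    -- set.
    let r : I → I → I := fun i =>
      if h : ∃ f, c (F f) = i then h.choose else id
    have hg : ∀ a : I, ∃ b, ∀ i < a, b ≠ r i a := by
      intro a
      by_contra! hc
      have hsurj : Function.Surjective fun i : Set.Iio a => r i a := fun b => by
        obtain ⟨i, hi, hb⟩ := hc b
        exact ⟨⟨i, hi⟩, hb.symm⟩
      exact (mk_le_of_surjective hsurj).not_gt (hIio a)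
    choose g hg using hg
    have hex : ∃ f, c (F f) = c (F g) := ⟨g, rfl⟩
    have hr : r (c (F g)) = hex.choose := dif_pos hex
    refine ⟨hex.choose, g, c (F g), c.injective hex.choose_spec, ?_⟩
    rintro _ ⟨⟨a, rfl⟩, b, hb⟩
    have hb' := e.injective hb
    simp only [Prod.mk.injEq] at hb'
    obtain ⟨rfl, hb'⟩ := hb'
    refine ⟨_, ?_, rfl⟩
    by_contra hlt
    exact hg b (c (F g)) (not_le.1 hlt) (by rw [hr]; exact hb')

end AlmostDisjoint

/-! ### Classes of simple modules and socles of prescribed type. -/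

section Simple

variable (A : Type u) [Ring A]

/-- Isomorphism of the simple modules `A ⧸ m`. -/
def simpleSetoid : Setoid {m : Submodule A A // IsCoatom m} where
  r m n := Nonempty ((A ⧸ m.1) ≃ₗ[A] (A ⧸ n.1))
  iseqv := ⟨fun _ => ⟨LinearEquiv.refl _ _⟩, fun ⟨e⟩ => ⟨e.symm⟩, fun ⟨e⟩ ⟨f⟩ => ⟨e.trans f⟩⟩

/-- The isomorphism classes of simple modules. -/
def SimpleClass : Type u := Quotient (simpleSetoid A)

variable {A}

/-- A maximal left ideal representing a class of simple modules. -/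
noncomputable def SimpleClass.ideal (ω : SimpleClass A) : Submodule A A := (Quotient.out ω).1

/-- A simple module representing a class of simple modules. -/
abbrev SimpleClass.Rep (ω : SimpleClass A) : Type u := A ⧸ ω.ideal

instance (ω : SimpleClass A) : IsSimpleModule A ω.Rep :=
  isSimpleModule_iff_isCoatom.2 (Quotient.out ω).2

theorem SimpleClass.eq_of_equiv {ω ω' : SimpleClass A} (e : ω.Rep ≃ₗ[A] ω'.Rep) : ω = ω' := by
  rw [← Quotient.out_eq ω, ← Quotient.out_eq ω']
  exact Quotient.sound (s := simpleSetoid A) ⟨e⟩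

theorem exists_simpleClass (D : Type u) [AddCommGroup D] [Module A D] [IsSimpleModule A D] :
    ∃ ω : SimpleClass A, Nonempty (D ≃ₗ[A] ω.Rep) := by
  obtain ⟨m, hm, ⟨e⟩⟩ := isSimpleModule_iff_quot_maximal.1 ‹IsSimpleModule A D›
  obtain ⟨e'⟩ := Quotient.mk_out (s := simpleSetoid A) ⟨m, Ideal.isMaximal_def.1 hm⟩
  exact ⟨Quotient.mk (simpleSetoid A) ⟨m, Ideal.isMaximal_def.1 hm⟩, ⟨e.trans e'.symm⟩⟩

variable {M N : Type u} [AddCommGroup M] [Module A M] [AddCommGroup N] [Module A N]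

/-- The sum of the simple submodules of `M` whose class lies in `B`. -/
def socleOver (B : Set (SimpleClass A)) (M : Type u) [AddCommGroup M] [Module A M] :
    Submodule A M :=
  sSup {S | ∃ ω ∈ B, ∃ f : ω.Rep →ₗ[A] M, Function.Injective f ∧ LinearMap.range f = S}

theorem range_le_socleOver {B : Set (SimpleClass A)} {ω : SimpleClass A} (hω : ω ∈ B)
    (f : ω.Rep →ₗ[A] M) : LinearMap.range f ≤ socleOver B M := by
  rcases f.injective_or_eq_zero with h | rfl
  · exact le_sSup ⟨ω, hω, f, h, rfl⟩
  · simp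

theorem socleOver_mono {B B' : Set (SimpleClass A)} (h : B ⊆ B') :
    socleOver B M ≤ socleOver B' M :=
  sSup_le_sSup fun _ ⟨ω, hω, hf⟩ => ⟨ω, h hω, hf⟩

theorem map_socleOver_le {B B' : Set (SimpleClass A)} (f : M →ₗ[A] N)
    (h : ∀ ω ∈ B, ω ∉ B' → ∀ g : ω.Rep →ₗ[A] N, g = 0) :
    (socleOver B M).map f ≤ socleOver B' N := by
  rw [Submodule.map_le_iff_le_comap]
  refine sSup_le ?_
  rintro _ ⟨ω, hω, g, -, rfl⟩
  rw [← Submodule.map_le_iff_le_comap, ← LinearMap.range_comp]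
  by_cases hB' : ω ∈ B'
  · exact range_le_socleOver hB' _
  · rw [h ω hω hB' (f ∘ₗ g)]
    simp

/-- A simple submodule of a sum of simple modules is isomorphic to one of the summands. -/
theorem mem_of_range_le_socleOver {B : Set (SimpleClass A)} {ω : SimpleClass A}
    {f : ω.Rep →ₗ[A] M} (hf : Function.Injective f)
    (h : LinearMap.range f ≤ socleOver B M) : ω ∈ B := by
  have e := LinearEquiv.ofInjective f hf
  have : IsSimpleModule A (LinearMap.range f) := IsSimpleModule.congr e.symm
  have : ∀ S : {S | ∃ ω ∈ B, ∃ f : ω.Rep →ₗ[A] M,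
      Function.Injective f ∧ LinearMap.range f = S}, IsSimpleModule A S.1 := by
    rintro ⟨_, ω', _, g, hg, rfl⟩
    exact IsSimpleModule.congr (LinearEquiv.ofInjective g hg).symm
  obtain ⟨_, ⟨ω', hω', g, hg, rfl⟩, ⟨e'⟩⟩ := Submodule.linearEquiv_of_le_sSup _ _ h
  have := SimpleClass.eq_of_equiv ((e.trans e').trans (LinearEquiv.ofInjective g hg).symm)
  rwa [this]

/-- An essential submodule contains every simple submodule. -/
theorem IsEssential.range_le {K : Submodule A M} (hK : IsEssential K) {D : Type u}
    [AddCommGroup D] [Module A D] [IsSimpleModule A D] (f : D →ₗ[A] M) :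
    LinearMap.range f ≤ K := by
  rcases eq_bot_or_eq_top (K.comap f) with h | h
  · have h1 : LinearMap.range f = ⊥ := by
      refine hK _ ?_
      rw [inf_comm, ← Submodule.map_comap_eq, h, Submodule.map_bot]
    rw [h1]
    exact bot_le
  · rw [LinearMap.range_eq_map, Submodule.map_le_iff_le_comap, h]

theorem not_isEssential_socleOver {B : Set (SimpleClass A)} {ω : SimpleClass A} (hω : ω ∉ B)
    {f : ω.Rep →ₗ[A] M} (hf : Function.Injective f) : ¬ IsEssential (socleOver B M) :=
  fun h => hω (mem_of_range_le_socleOver hf (h.range_le f))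

theorem eq_zero_of_isEssential_socleOver {B : Set (SimpleClass A)}
    (h : IsEssential (socleOver B M)) {ω : SimpleClass A} (hω : ω ∉ B) (g : ω.Rep →ₗ[A] M) :
    g = 0 :=
  (g.injective_or_eq_zero).resolve_left fun hg => not_isEssential_socleOver hω hg h

/-- A projective module embeds in a free module. -/
theorem exists_coordinates (P : Type u) [AddCommGroup P] [Module A P] [Module.Projective A P] :
    ∃ s : P →ₗ[A] P →₀ A, Function.Injective s := by
  obtain ⟨s, hs⟩ := Module.projective_def'.1 (inferInstance : Module.Projective A P)
  exact ⟨s, Function.LeftInverse.injective (g := Finsupp.linearCombination A id)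
    (LinearMap.congr_fun hs)⟩

end Simple

/-! ### A CEP ring has finitely many simple classes. -/

section CEP

variable (A : Type u) [Ring A]

/-- Every cyclic module essentially embeds in a projective module. -/
def IsCEP : Prop :=
  ∀ (N : Type u) [AddCommGroup N] [Module A N], IsCyclicModule A N →
    ∃ (P : Type u) (_ : AddCommGroup P) (_ : Module A P),
      Module.Projective A P ∧ EssentiallyEmbeds A N P

variable {A}

theorem isCyclicModule_of_surjective {N : Type u} [AddCommGroup N] [Module A N] (f : A →ₗ[A] N)
    (hf : Function.Surjective f) : IsCyclicModule A N := by
  refine ⟨f 1, eq_top_iff.2 fun y _ => ?_⟩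
  obtain ⟨a, rfl⟩ := hf y
  exact Submodule.mem_span_singleton.2 ⟨a, by rw [← map_smul, smul_eq_mul, mul_one]⟩

theorem isCyclicModule_quotient (K : Submodule A A) : IsCyclicModule A (A ⧸ K) :=
  isCyclicModule_of_surjective K.mkQ (Submodule.mkQ_surjective K)

/-- The simple module lies in a projective, hence in a free module; a coordinate not vanishing on it
is injective by simplicity. -/
theorem IsCEP.exists_injective_rep (h : IsCEP A) (ω : SimpleClass A) :
    ∃ f : ω.Rep →ₗ[A] A, Function.Injective f := by
  obtain ⟨P, _, _, hP, i, hi, -⟩ := h ω.Rep (isCyclicModule_quotient _)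
  obtain ⟨s, hs⟩ := exists_coordinates (A := A) P
  have : Nontrivial ω.Rep := IsSimpleModule.nontrivial A _
  obtain ⟨x, hx⟩ := exists_ne (0 : ω.Rep)
  have h1 : s (i x) ≠ 0 := fun h0 => hx (hi (hs (by rw [h0, map_zero, map_zero])))
  obtain ⟨p, hp⟩ := Finsupp.ne_iff.1 h1
  refine ⟨Finsupp.lapply p ∘ₗ s ∘ₗ i, LinearMap.injective_of_ne_zero fun h0 => hp ?_⟩
  simpa using LinearMap.congr_fun h0 x

/-- Every submodule `U` of `M` becomes essential in a quotient of `M` in which it embeds. -/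
theorem exists_isEssential_map_mkQ {M : Type u} [AddCommGroup M] [Module A M]
    (U : Submodule A M) :
    ∃ L : Submodule A M, U ⊓ L = ⊥ ∧ IsEssential (U.map L.mkQ) := by
  obtain ⟨L, -, hL⟩ := zorn_le_nonempty₀ {F : Submodule A M | U ⊓ F = ⊥}
    (by
      intro c hc hchain y hy
      refine ⟨sSup c, ?_, fun z hz => le_sSup hz⟩
      change U ⊓ sSup c = ⊥
      rw [eq_bot_iff]
      rintro b ⟨hbU, hb⟩
      obtain ⟨F, hF, hbF⟩ := (Submodule.mem_sSup_of_directed ⟨y, hy⟩ hchain.directedOn).1 hb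
      have h2 : U ⊓ F = ⊥ := hc hF
      rw [← h2]
      exact ⟨hbU, hbF⟩)
    ⊥ (by simp)
  refine ⟨L, hL.1, fun B hB => ?_⟩
  have h1 : B.comap L.mkQ ≤ L := by
    refine hL.2 (y := B.comap L.mkQ) ?_ (Submodule.le_comap_mkQ L B)
    change U ⊓ B.comap L.mkQ = ⊥
    rw [eq_bot_iff]
    rintro x ⟨hxU, hxB⟩
    have h2 : L.mkQ x ∈ U.map L.mkQ ⊓ B := ⟨⟨x, hxU, rfl⟩, hxB⟩
    rw [hB, Submodule.mem_bot, Submodule.mkQ_apply, Submodule.Quotient.mk_eq_zero] at h2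
    rw [← hL.1]
    exact ⟨hxU, h2⟩
  rw [← Submodule.map_comap_eq_of_surjective (Submodule.mkQ_surjective L) B, eq_bot_iff,
    Submodule.map_le_iff_le_comap]
  intro x hx
  simpa using h1 hx

theorem IsEssentialEmbedding.isEssential_span {M N : Type u} [AddCommGroup M] [Module A M]
    [AddCommGroup N] [Module A N] {f : M →ₗ[A] N} (hf : IsEssentialEmbedding f) {x : M}
    (hx : Submodule.span A {x} = ⊤) : IsEssential (Submodule.span A {f x}) := by
  rw [← Set.image_singleton, Submodule.span_image, hx, ← LinearMap.range_eq_map]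
  exact hf.2

/-- Over a CEP ring any set of classes of simple modules is realized by the essential socle of a
projective module with an essential cyclic submodule. -/
theorem IsCEP.exists_projective_socle (h : IsCEP A) (S : Set (SimpleClass A)) :
    ∃ (P : Type u) (_ : AddCommGroup P) (_ : Module A P) (x : P), Module.Projective A P ∧
      IsEssential (Submodule.span A {x}) ∧ IsEssential (socleOver S P) ∧
      ∀ ω ∈ S, ∃ f : ω.Rep →ₗ[A] P, Function.Injective f := by
  -- Factoring out `L` makes the socle of type `S` essential and leaves its simple submodules
  -- intact, while the quotient is still cyclic.
  obtain ⟨L, hL, hess⟩ := exists_isEssential_map_mkQ (socleOver S A)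
  have hcyc := isCyclicModule_quotient L
  obtain ⟨P, _, _, hP, i, hi⟩ := h (A ⧸ L) hcyc
  obtain ⟨x, hx⟩ := hcyc
  refine ⟨P, _, _, i x, hP, hi.isEssential_span hx, ?_, fun ω hω => ?_⟩
  · refine (hess.map hi).mono ?_
    rw [← Submodule.map_comp]
    exact map_socleOver_le _ fun ω h1 h2 => absurd h1 h2
  · obtain ⟨f, hf⟩ := h.exists_injective_rep ω
    refine ⟨i ∘ₗ L.mkQ ∘ₗ f, hi.1.comp ?_⟩
    rw [← LinearMap.ker_eq_bot, LinearMap.ker_comp, Submodule.ker_mkQ, eq_bot_iff]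
    intro y hy
    have : f y ∈ socleOver S A ⊓ L := ⟨range_le_socleOver hω f ⟨y, rfl⟩, hy⟩
    rw [hL, Submodule.mem_bot] at this
    exact hf (by rw [this, map_zero])

/-- If two maximal submodules of projective modules have isomorphic quotients, there is a
homomorphism between the modules which is not into the second maximal submodule. -/
theorem exists_not_range_le {P Q D : Type u} [AddCommGroup P] [Module A P] [AddCommGroup Q]
    [Module A Q] [AddCommGroup D] [Module A D] [Module.Projective A P] {M : Submodule A Q}
    (p : P →ₗ[A] D) (hp : p ≠ 0) (e : D ≃ₗ[A] (Q ⧸ M)) :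
    ∃ f : P →ₗ[A] Q, ¬ LinearMap.range f ≤ M ∧ ∀ x, M.mkQ (f x) = e (p x) := by
  obtain ⟨f, hf⟩ := Module.projective_lifting_property M.mkQ (e.toLinearMap ∘ₗ p)
    (Submodule.mkQ_surjective M)
  have hf' : ∀ x, M.mkQ (f x) = e (p x) := fun x => LinearMap.congr_fun hf x
  refine ⟨f, fun hle => hp ?_, hf'⟩
  ext x
  apply e.injective
  rw [← hf', LinearMap.zero_apply, map_zero]
  simpa using hle ⟨x, rfl⟩

/-- Over a CEP ring, given a set `S` of classes of simple modules and a directed family of sets not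
containing `S`, there is a projective module whose socle is essential of type `S`, with a maximal
submodule above the singular closures of the smaller socles. -/
theorem IsCEP.exists_projective_isCoatom (h : IsCEP A) (S : Set (SimpleClass A)) {I : Type*}
    [Nonempty I] {B : I → Set (SimpleClass A)} (hB : Directed (· ≤ ·) B)
    (hSB : ∀ j, ¬ S ⊆ B j) :
    ∃ (ω : SimpleClass A) (P : Type u) (_ : AddCommGroup P) (_ : Module A P)
      (M : Submodule A P), Module.Projective A P ∧ IsEssential (socleOver S P) ∧
      Nonempty (ω.Rep ≃ₗ[A] (P ⧸ M)) ∧ ∀ j, singularOver (socleOver (B j) P) ≤ M := by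
  obtain ⟨P, _, _, x, hP, hx, hess, hemb⟩ := h.exists_projective_socle S
  obtain ⟨M, hM, hle⟩ := exists_isCoatom_of_directed (σ := fun j => socleOver (B j) P) hx
    (fun i j => by
      obtain ⟨k, hik, hjk⟩ := hB i j
      exact ⟨k, socleOver_mono hik, socleOver_mono hjk⟩) (by
      intro j
      obtain ⟨ω, hω, hωB⟩ := Set.not_subset.1 (hSB j)
      obtain ⟨g, hg⟩ := hemb ω hω
      exact not_isEssential_socleOver hωB hg)
  have := isSimpleModule_iff_isCoatom.2 hM
  obtain ⟨ω, ⟨e⟩⟩ := exists_simpleClass (A := A) (P ⧸ M)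
  exact ⟨ω, P, _, _, M, hP, hess, ⟨e.symm⟩, hle⟩

theorem exists_not_range_le_of_equiv {P Q D : Type u} [AddCommGroup P] [Module A P]
    [AddCommGroup Q] [Module A Q] [AddCommGroup D] [Module A D] [Nontrivial D]
    [Module.Projective A P] {L : Submodule A P} {M : Submodule A Q}
    (e : D ≃ₗ[A] (P ⧸ L)) (e' : D ≃ₗ[A] (Q ⧸ M)) :
    ∃ f : P →ₗ[A] Q, ¬ LinearMap.range f ≤ M := by
  obtain ⟨d, hd⟩ := exists_ne (0 : D)
  obtain ⟨x, hx⟩ := Submodule.mkQ_surjective L (e d)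
  obtain ⟨f, hf, -⟩ := exists_not_range_le (e.symm.toLinearMap ∘ₗ L.mkQ) (fun h0 => hd (by
    have := LinearMap.congr_fun h0 x
    simpa [hx] using this)) e'
  exact ⟨f, hf⟩

/-- Colour `f` by the simple quotient of a projective whose essential socle has type `U f`. For two
equal colours, a homomorphism between the projectives sends the socle into types in `U f ∩ U g ⊆ B
j`. Its range is then singular over the socle of type `B j`, so it lies in the maximal submodule,
although the homomorphism was chosen to avoid this. -/
theorem IsCEP.finite_simpleClass (h : IsCEP A) : Finite (SimpleClass A) := by
  rw [← not_infinite_iff_finite]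
  intro hinf
  obtain ⟨I, U, B, hI, hdir, hUB, hcol⟩ := exists_almostDisjoint_family (SimpleClass A)
  choose F hF using fun f => h.exists_projective_isCoatom (U f) hdir (hUB f)
  obtain ⟨f, g, j, hFfg, hfg⟩ := hcol F
  obtain ⟨P, _, _, L, hP, hPess, ⟨e⟩, -⟩ := hF f
  obtain ⟨Q, _, _, M, -, hQess, ⟨e'⟩, hle⟩ := hF g
  rw [← hFfg] at e'
  have : Nontrivial (F f).Rep := IsSimpleModule.nontrivial A _
  obtain ⟨k, hk⟩ := exists_not_range_le_of_equiv e e'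
  refine hk ((hPess.range_le_singularOver ?_).trans (hle j))
  refine map_socleOver_le k fun ω hω hωB => ?_
  exact eq_zero_of_isEssential_socleOver hQess fun hωg => hωB (hfg ⟨hω, hωg⟩)

end CEP

variable {A : Type u} [Ring A]

/-! ### Finite cogeneration. -/

section FinitelyCogenerated

variable {M N : Type*} [AddCommGroup M] [Module A M] [AddCommGroup N] [Module A N]

variable (A M) in
/-- `M` is finitely cogenerated: a decreasing sequence of submodules with zero intersection
reaches zero. -/
def IsFinitelyCogenerated : Prop :=
  ∀ K : ℕ → Submodule A M, Antitone K → (∀ x, (∀ n, x ∈ K n) → x = 0) → ∃ n, K n = ⊥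

theorem IsFinitelyCogenerated.of_injective (h : IsFinitelyCogenerated A N) (f : M →ₗ[A] N)
    (hf : Function.Injective f) : IsFinitelyCogenerated A M := by
  intro K hK h0
  obtain ⟨n, hn⟩ := h (fun n => (K n).map f) (fun a b hab => Submodule.map_mono (hK hab)) (by
    intro y hy
    obtain ⟨x, -, rfl⟩ := hy 0
    rw [h0 x fun n => ?_, map_zero]
    obtain ⟨z, hz, hzx⟩ := hy n
    rwa [← hf hzx])
  exact ⟨n, Submodule.map_injective_of_injective hf (by rw [hn, Submodule.map_bot])⟩

/-- From some `n` on, `K n` meets the kernel trivially. Then `f` is injective on `K n`, and the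
images of the later terms still intersect in zero. -/
theorem IsFinitelyCogenerated.of_ker (f : M →ₗ[A] N)
    (h : IsFinitelyCogenerated A (LinearMap.ker f)) (hN : IsFinitelyCogenerated A N) :
    IsFinitelyCogenerated A M := by
  intro K hK h0
  obtain ⟨n, hn⟩ := h (fun n => (K n).comap (LinearMap.ker f).subtype)
    (fun a b hab => Submodule.comap_mono (hK hab)) (fun x hx => Subtype.ext (h0 x hx))
  have hinj : ∀ x ∈ K n, f x = 0 → x = 0 := fun x hx hfx => by
    have : (⟨x, hfx⟩ : LinearMap.ker f) ∈ (K n).comap (LinearMap.ker f).subtype := hx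
    rw [hn, Submodule.mem_bot] at this
    exact congrArg Subtype.val this
  obtain ⟨m, hm⟩ := hN (fun m => (K (n + m)).map f)
    (fun a b hab => Submodule.map_mono (hK (by omega))) (by
      intro y hy
      obtain ⟨x, hx, rfl⟩ := hy 0
      rw [h0 x fun m => ?_, map_zero]
      obtain ⟨z, hz, hzx⟩ := hy m
      have hzx' : x - z = 0 := hinj _
        (Submodule.sub_mem _ hx (hK (by omega) hz)) (by rw [map_sub, hzx, sub_self])
      rw [sub_eq_zero.1 hzx']
      exact hK (by omega) hz)
  refine ⟨n + m, eq_bot_iff.2 fun x hx => hinj x (hK (by omega) hx) ?_⟩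
  have : f x ∈ (K (n + m)).map f := ⟨x, hx, rfl⟩
  simpa [hm] using this

theorem isFinitelyCogenerated_of_subsingleton [Subsingleton M] : IsFinitelyCogenerated A M :=
  fun _ _ _ => ⟨0, Subsingleton.elim _ _⟩

theorem isFinitelyCogenerated_of_finset {ι : Type*} {Y : ι → Type*}
    [∀ i, AddCommGroup (Y i)] [∀ i, Module A (Y i)] (hY : ∀ i, IsFinitelyCogenerated A (Y i))
    (f : ∀ i, M →ₗ[A] Y i) (s : Finset ι) (K : Submodule A M)
    (h : ∀ x ∈ K, (∀ i ∈ s, f i x = 0) → x = 0) : IsFinitelyCogenerated A K := by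
  classical
  induction s using Finset.induction_on generalizing K with
  | empty =>
    have : Subsingleton K := ⟨fun x y => Subtype.ext (by
      rw [h x x.2 (by simp), h y y.2 (by simp)])⟩
    exact isFinitelyCogenerated_of_subsingleton
  | insert i s _ ih =>
    have h1 := ih (K ⊓ LinearMap.ker (f i)) (fun x hx hs => h x hx.1 (by
      intro j hj
      rcases Finset.mem_insert.1 hj with rfl | hj
      · exact hx.2
      · exact hs j hj))
    refine IsFinitelyCogenerated.of_ker (f i ∘ₗ K.subtype) (h1.of_injective
      ((K.subtype ∘ₗ (LinearMap.ker (f i ∘ₗ K.subtype)).subtype).codRestrict _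
        fun x => ⟨x.1.2, x.2⟩) ?_) (hY i)
    intro x y hxy
    have h2 := congrArg Subtype.val hxy
    exact Subtype.ext (Subtype.ext h2)

theorem isFinitelyCogenerated_of_finset' {ι : Type*} {Y : ι → Type*}
    [∀ i, AddCommGroup (Y i)] [∀ i, Module A (Y i)] (hY : ∀ i, IsFinitelyCogenerated A (Y i))
    (f : ∀ i, M →ₗ[A] Y i) (s : Finset ι)
    (h : ∀ x, (∀ i ∈ s, f i x = 0) → x = 0) : IsFinitelyCogenerated A M :=
  (isFinitelyCogenerated_of_finset hY f s ⊤ fun x _ => h x).of_injective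
    (Submodule.topEquiv (R := A) (M := M)).symm.toLinearMap
    (Submodule.topEquiv (R := A) (M := M)).symm.injective

/-- Every nonzero submodule of `P` contains the image of `D`. -/
theorem isFinitelyCogenerated_of_isEssentialEmbedding {D P : Type u} [AddCommGroup D]
    [Module A D] [IsSimpleModule A D] [AddCommGroup P] [Module A P] {i : D →ₗ[A] P}
    (hi : IsEssentialEmbedding i) : IsFinitelyCogenerated A P := by
  intro K _ h0
  by_contra! hne
  have : Nontrivial D := IsSimpleModule.nontrivial A D
  obtain ⟨d, hd⟩ := exists_ne (0 : D)
  refine hd (hi.1 ?_)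
  rw [map_zero]
  refine h0 _ fun n => ?_
  rcases eq_bot_or_eq_top ((K n).comap i) with h | h
  · refine absurd (hi.2 (K n) ?_) (hne n)
    rw [← Submodule.map_comap_eq, h, Submodule.map_bot]
  · have : d ∈ (K n).comap i := h ▸ Submodule.mem_top
    exact this

theorem isArtinian_of_isFinitelyCogenerated_quotient
    (h : ∀ K : Submodule A M, IsFinitelyCogenerated A (M ⧸ K)) : IsArtinian A M := by
  rw [← monotone_stabilizes_iff_artinian]
  intro f
  let g : ℕ → Submodule A M := fun n => OrderDual.ofDual (f n)
  have hg : Antitone g := fun a b hab => f.monotone hab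
  have hK : ∀ n, ⨅ n, g n ≤ g n := iInf_le g
  obtain ⟨n, hn⟩ := h (⨅ n, g n) (fun n => (g n).map (Submodule.mkQ _))
    (fun a b hab => Submodule.map_mono (hg hab)) (by
      intro y hy
      obtain ⟨x, rfl⟩ := Submodule.mkQ_surjective _ y
      rw [Submodule.mkQ_apply, Submodule.Quotient.mk_eq_zero, Submodule.mem_iInf]
      intro n
      obtain ⟨z, hz, hzx⟩ := hy n
      have := hK n ((Submodule.Quotient.eq _).1 hzx)
      exact (Submodule.sub_mem_iff_right _ hz).1 this)
  refine ⟨n, fun m hm => le_antisymm (f.monotone hm) ?_⟩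
  change g n ≤ g m
  refine le_trans ?_ (hK m)
  rw [eq_bot_iff, Submodule.map_le_iff_le_comap] at hn
  exact fun x hx => by simpa using hn hx

end FinitelyCogenerated

/-! ### A CEP ring is artinian. -/

/-- A projective module with an essential cyclic submodule embeds in a free module of finite
rank. -/
theorem exists_injective_pi {P : Type u} [AddCommGroup P] [Module A P] [Module.Projective A P]
    {x : P} (hx : IsEssential (Submodule.span A {x})) :
    ∃ (F : Finset P) (f : P →ₗ[A] F → A), Function.Injective f := by
  obtain ⟨s, hs⟩ := exists_coordinates (A := A) P
  -- The coordinates outside the support of `s x` vanish on the essential submodule generated by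
  -- `x`, so the remaining ones suffice for injectivity.
  refine ⟨(s x).support, LinearMap.pi fun p => Finsupp.lapply p.1 ∘ₗ s, hx.injective ?_⟩
  rw [eq_bot_iff]
  rintro y ⟨hy, hy0⟩
  obtain ⟨a, rfl⟩ := Submodule.mem_span_singleton.1 hy
  rw [Submodule.mem_bot]
  apply hs
  ext p
  by_cases hp : p ∈ (s x).support
  · simpa using congrFun (LinearMap.mem_ker.1 hy0) ⟨p, hp⟩
  · simp [Finsupp.notMem_support_iff.1 hp]

/-- Over a CEP ring there is, for every simple module, a projective module in which it is
essential, with a maximal submodule containing all singular elements; the simple quotients so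
obtained exhaust all simple modules. -/
theorem IsCEP.exists_uniform_cover (h : IsCEP A) :
    ∃ t : SimpleClass A → SimpleClass A, Function.Surjective t ∧ ∀ ω,
      ∃ (P : Type u) (_ : AddCommGroup P) (_ : Module A P) (M : Submodule A P)
        (i : ω.Rep →ₗ[A] P), Module.Projective A P ∧ IsEssentialEmbedding i ∧
        Nonempty ((t ω).Rep ≃ₗ[A] (P ⧸ M)) ∧ singularOver (⊥ : Submodule A P) ≤ M ∧
        ∃ (F : Finset P) (f : P →ₗ[A] F → A), Function.Injective f := by
  have hfin := h.finite_simpleClass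
  have key : ∀ ω : SimpleClass A, ∃ (ω' : SimpleClass A) (P : Type u) (_ : AddCommGroup P)
      (_ : Module A P) (M : Submodule A P) (i : ω.Rep →ₗ[A] P), Module.Projective A P ∧
      IsEssentialEmbedding i ∧ Nonempty (ω'.Rep ≃ₗ[A] (P ⧸ M)) ∧
      singularOver (⊥ : Submodule A P) ≤ M ∧
      ∃ (F : Finset P) (f : P →ₗ[A] F → A), Function.Injective f := by
    intro ω'
    obtain ⟨P, _, _, hP, i, hi⟩ := h ω'.Rep (isCyclicModule_quotient _)
    obtain ⟨x, hx⟩ := isCyclicModule_quotient ω'.ideal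
    have : Nontrivial ω'.Rep := IsSimpleModule.nontrivial A _
    have : Nontrivial P := hi.1.nontrivial
    obtain ⟨M, hM, hle⟩ := exists_isCoatom_of_directed (σ := fun _ : Unit => (⊥ : Submodule A P))
      (hi.isEssential_span hx) (fun _ _ => ⟨(), le_rfl, le_rfl⟩)
      (fun _ hb => top_ne_bot (hb ⊤ (bot_inf_eq _)))
    have := isSimpleModule_iff_isCoatom.2 hM
    obtain ⟨ω, ⟨e⟩⟩ := exists_simpleClass (A := A) (P ⧸ M)
    exact ⟨ω, P, _, _, M, i, hP, hi, ⟨e.symm⟩, hle (), exists_injective_pi (hi.isEssential_span hx)⟩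
  choose t ht using key
  -- A homomorphism `f` not into `M` cannot kill the essential simple submodule of its source, since
  -- its range would be singular. So it carries this submodule isomorphically onto the essential
  -- simple submodule of the target.
  have hinj : Function.Injective t := by
    intro ω₁ ω₂ h12
    obtain ⟨P, _, _, L, i, hP, hi, ⟨e⟩, -⟩ := ht ω₁
    obtain ⟨Q, _, _, M, j, -, hj, ⟨e'⟩, hM, -⟩ := ht ω₂
    rw [← h12] at e'
    have : Nontrivial (t ω₁).Rep := IsSimpleModule.nontrivial A _
    obtain ⟨f, hf⟩ := exists_not_range_le_of_equiv e e'
    have hne : f ∘ₗ i ≠ 0 := fun h0 => hf ((hi.2.range_le_singularOver (by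
      rw [← LinearMap.range_comp, h0, LinearMap.range_zero])).trans hM)
    have h1 := hj.2.range_le (f ∘ₗ i)
    let g : ω₁.Rep →ₗ[A] LinearMap.range j := (f ∘ₗ i).codRestrict _ fun x => h1 ⟨x, rfl⟩
    have hg : g ≠ 0 := fun h0 => hne (by
      refine LinearMap.ext fun x => ?_
      exact congrArg Subtype.val (LinearMap.congr_fun h0 x))
    have e₂ := LinearEquiv.ofInjective j hj.1
    have := IsSimpleModule.congr e₂.symm
    exact SimpleClass.eq_of_equiv
      ((LinearEquiv.ofBijective g (LinearMap.bijective_of_ne_zero hg)).trans e₂.symm)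
  exact ⟨t, Finite.injective_iff_surjective.1 hinj, ht⟩

theorem IsCEP.exists_not_range_le_maximal (h : IsCEP A) (m : {m : Submodule A A // IsCoatom m}) :
    ∃ (P : Type u) (_ : AddCommGroup P) (_ : Module A P) (f : P →ₗ[A] A),
      IsFinitelyCogenerated A P ∧ ¬ LinearMap.range f ≤ m := by
  have := isSimpleModule_iff_isCoatom.2 m.2
  obtain ⟨ω, ⟨e⟩⟩ := exists_simpleClass (A := A) (A ⧸ m.1)
  obtain ⟨t, ht, hcov⟩ := h.exists_uniform_cover
  obtain ⟨ω, rfl⟩ := ht ω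
  obtain ⟨P, _, _, M, i, hP, hi, ⟨e'⟩, -⟩ := hcov ω
  have : Nontrivial (t ω).Rep := IsSimpleModule.nontrivial A _
  obtain ⟨f, hf⟩ := exists_not_range_le_of_equiv e' e.symm
  exact ⟨P, _, _, f, isFinitelyCogenerated_of_isEssentialEmbedding hi, hf⟩

/-- The images of finitely cogenerated modules in `A` lie in no common maximal left ideal, so their
direct sum maps onto `A`. The map splits, and the image of `1` has finite support, so `A` embeds in
a finite product of them. -/
theorem IsCEP.isFinitelyCogenerated (h : IsCEP A) : IsFinitelyCogenerated A A := by
  classical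
  choose P instG instM f hP hf using h.exists_not_range_le_maximal
  let φ : (Π₀ m, P m) →ₗ[A] A := DFinsupp.lsum ℕ f
  have hφ : Function.Surjective φ := by
    rw [← LinearMap.range_eq_top]
    by_contra hne
    obtain ⟨m, hm, hle⟩ := (eq_top_or_exists_le_coatom (LinearMap.range φ)).resolve_left hne
    refine hf ⟨m, hm⟩ (le_trans ?_ hle)
    rintro _ ⟨x, rfl⟩
    exact ⟨DFinsupp.single ⟨m, hm⟩ x, by simp [φ]⟩
  obtain ⟨s, hs⟩ := Module.projective_lifting_property φ LinearMap.id hφ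
  refine isFinitelyCogenerated_of_finset' hP (fun m => DFinsupp.lapply m ∘ₗ s) (s 1).support
    fun a ha => ?_
  have hsa : s a = a • s 1 := by rw [← map_smul, smul_eq_mul, mul_one]
  have h0 : s a = 0 := by
    ext m
    by_cases hm : m ∈ (s 1).support
    · exact ha m hm
    · rw [hsa, DFinsupp.smul_apply, DFinsupp.notMem_support_iff.1 hm]
      simp
  rw [← LinearMap.id_apply (R := A) a, ← hs, LinearMap.comp_apply, h0, map_zero]

/-- A CEP ring is artinian. -/
theorem IsCEP.isArtinian (h : IsCEP A) : IsArtinian A A := by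
  refine isArtinian_of_isFinitelyCogenerated_quotient fun K => ?_
  have hcyc := isCyclicModule_quotient K
  obtain ⟨P, _, _, hP, i, hi⟩ := h (A ⧸ K) hcyc
  obtain ⟨x, hx⟩ := hcyc
  obtain ⟨F, f, hf⟩ := exists_injective_pi (hi.isEssential_span hx)
  refine isFinitelyCogenerated_of_finset' (fun _ => h.isFinitelyCogenerated)
    (fun p : F => LinearMap.proj p ∘ₗ f ∘ₗ i) Finset.univ fun x hx => ?_
  refine hi.1 (hf ?_)
  ext p
  simpa using hx p (Finset.mem_univ p)

/-! ### Indecomposable projectives over a CEP ring. -/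

/-- A nonzero projective module over a noetherian ring has a simple quotient. -/
theorem exists_simple_quotient [IsNoetherianRing A] (Q : Type u) [AddCommGroup Q] [Module A Q]
    [Module.Projective A Q] [Nontrivial Q] :
    ∃ (ω : SimpleClass A) (p : Q →ₗ[A] ω.Rep), p ≠ 0 := by
  obtain ⟨s, hs⟩ := exists_coordinates (A := A) Q
  obtain ⟨x, hx⟩ := exists_ne (0 : Q)
  obtain ⟨q, hq⟩ := Finsupp.ne_iff.1 (fun h0 : s x = 0 => hx (hs (by rw [h0, map_zero])))
  let φ : Q →ₗ[A] A := Finsupp.lapply q ∘ₗ s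
  have hnt : Nontrivial (LinearMap.range φ) :=
    ⟨⟨⟨φ x, x, rfl⟩, 0, fun h0 => hq (congrArg Subtype.val h0)⟩⟩
  obtain ⟨M, hM, -⟩ := (eq_top_or_exists_le_coatom
    (⊥ : Submodule A (LinearMap.range φ))).resolve_left bot_ne_top
  have := isSimpleModule_iff_isCoatom.2 hM
  obtain ⟨ω, ⟨e⟩⟩ := exists_simpleClass (A := A) (LinearMap.range φ ⧸ M)
  refine ⟨ω, e.toLinearMap ∘ₗ M.mkQ ∘ₗ φ.rangeRestrict, fun h0 => hM.1 ?_⟩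
  rw [eq_top_iff]
  intro y _
  obtain ⟨z, rfl⟩ := φ.surjective_rangeRestrict y
  have := LinearMap.congr_fun h0 z
  simpa using this

/-- If an injective endomorphism of a nonzero artinian module factors through an indecomposable
module, the two modules are isomorphic. -/
theorem IsIndecomposable.nonempty_equiv {P Q : Type u} [AddCommGroup P] [Module A P]
    [AddCommGroup Q] [Module A Q] [IsArtinian A P] [Nontrivial P] (hQ : IsIndecomposable A Q)
    (g : P →ₗ[A] Q) (k : Q →ₗ[A] P) (hkg : Function.Injective (k ∘ₗ g)) :
    Nonempty (P ≃ₗ[A] Q) := by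
  have hbij := IsArtinian.bijective_of_injective_endomorphism _ hkg
  have hg : Function.Injective g := Function.Injective.of_comp (f := k) hkg
  have hcompl : IsCompl (LinearMap.range g) (LinearMap.ker k) := by
    rw [isCompl_iff, disjoint_iff, codisjoint_iff]
    constructor
    · rw [eq_bot_iff]
      rintro _ ⟨⟨x, rfl⟩, hx⟩
      have : x = 0 := hkg (by rw [map_zero]; exact hx)
      simp [this]
    · rw [eq_top_iff]
      intro y _
      obtain ⟨x, hx⟩ := hbij.2 (k y)
      have hx' : k (g x) = k y := hx
      rw [← add_sub_cancel (g x) y]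
      refine Submodule.add_mem_sup ⟨x, rfl⟩ ?_
      rw [LinearMap.mem_ker, map_sub, hx', sub_self]
  rcases hQ.2 _ _ hcompl with h | h
  · exfalso
    obtain ⟨x, hx⟩ := exists_ne (0 : P)
    refine hx (hg ?_)
    have : g x ∈ LinearMap.range g := ⟨x, rfl⟩
    rwa [h, Submodule.mem_bot, ← map_zero g] at this
  · refine ⟨LinearEquiv.ofBijective g ⟨hg, ?_⟩⟩
    have := hcompl.sup_eq_top
    rwa [h, sup_bot_eq, LinearMap.range_eq_top] at this

theorem isUniform_of_isSimpleModule (D : Type u) [AddCommGroup D] [Module A D]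
    [IsSimpleModule A D] : IsUniform A D := fun K hK => by
  rw [(eq_bot_or_eq_top K).resolve_left hK]
  exact isEssential_top

/-- Over a CEP ring the indecomposable projective modules are determined by their essential simple
submodule. -/
theorem IsCEP.exists_simple_classification (h : IsCEP A) :
    ∃ P : SimpleClass A → ModuleCat.{u} A,
      (∀ ω, ∃ i : ω.Rep →ₗ[A] P ω, IsEssentialEmbedding i) ∧
      ∀ (Q : Type u) [AddCommGroup Q] [Module A Q], Module.Projective A Q →
        IsIndecomposable A Q → ∃ ω, Nonempty (P ω ≃ₗ[A] Q) := by
  have hart : IsArtinianRing A := h.isArtinian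
  obtain ⟨t, ht, hcov⟩ := h.exists_uniform_cover
  have hcov' : ∀ ω, ∃ P : ModuleCat.{u} A, Module.Projective A P ∧
      (∃ i : ω.Rep →ₗ[A] P, IsEssentialEmbedding i) ∧ IsArtinian A P ∧ ∃ M : Submodule A P,
        singularOver (⊥ : Submodule A P) ≤ M ∧ Nonempty ((t ω).Rep ≃ₗ[A] (P ⧸ M)) := by
    intro ω
    obtain ⟨P, _, _, M, i, hP, hi, he, hM, F, f, hf⟩ := hcov ω
    exact ⟨ModuleCat.of A P, hP, ⟨i, hi⟩, isArtinian_of_injective f hf, M, hM, he⟩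
  choose P hP hi hartP M hM he using hcov'
  refine ⟨P, hi, fun Q _ _ hQ hQi => ?_⟩
  have := hQi.1
  obtain ⟨τ, p, hp⟩ := exists_simple_quotient (A := A) Q
  obtain ⟨ω, rfl⟩ := ht τ
  refine ⟨ω, ?_⟩
  obtain ⟨e⟩ := he ω
  obtain ⟨i, hi⟩ := hi ω
  have hpsurj := LinearMap.surjective_of_ne_zero hp
  have : Nontrivial (t ω).Rep := IsSimpleModule.nontrivial A _
  have : Nontrivial ω.Rep := IsSimpleModule.nontrivial A _
  have : Nontrivial (P ω) := hi.1.nontrivial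
  have := hP ω
  have := hartP ω
  obtain ⟨g, hg⟩ := Module.projective_lifting_property p (e.symm.toLinearMap ∘ₗ (M ω).mkQ) hpsurj
  obtain ⟨k, -, hk⟩ := exists_not_range_le p hp e
  refine hQi.nonempty_equiv g k ?_
  -- `k ∘ₗ g` is the identity modulo `M ω`. If it killed the essential simple submodule, its range
  -- would be singular and lie in `M ω`. So it is injective there, hence everywhere.
  have hkg : ∀ x, (M ω).mkQ (k (g x)) = (M ω).mkQ x := fun x => by
    have h1 : p (g x) = e.symm ((M ω).mkQ x) := LinearMap.congr_fun hg x
    rw [hk, h1, LinearEquiv.apply_symm_apply]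
  have hne : (k ∘ₗ g) ∘ₗ i ≠ 0 := by
    intro h0
    have h1 := (hi.2.range_le_singularOver (f := k ∘ₗ g) (K := ⊥) (by
      rw [← LinearMap.range_comp, h0, LinearMap.range_zero])).trans (hM ω)
    obtain ⟨d, hd⟩ := exists_ne (0 : (t ω).Rep)
    obtain ⟨x, hx⟩ := Submodule.mkQ_surjective (M ω) (e d)
    have h2 : (M ω).mkQ (k (g x)) = 0 := by simpa using h1 ⟨x, rfl⟩
    rw [hkg, hx] at h2
    exact hd (by simpa using h2)
  refine hi.2.injective ?_
  rw [eq_bot_iff]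
  rintro _ ⟨⟨d, rfl⟩, hd⟩
  have : d = 0 := LinearMap.injective_of_ne_zero hne (by rw [map_zero]; exact hd)
  simp [this]

/-- Over a CEP ring the indecomposable projective modules are uniform. -/
theorem IsCEP.isUniform (h : IsCEP A) {Q : Type u} [AddCommGroup Q] [Module A Q]
    [hQ : Module.Projective A Q] (hQi : IsIndecomposable A Q) : IsUniform A Q := by
  obtain ⟨P, hP, hcl⟩ := h.exists_simple_classification
  obtain ⟨ω, ⟨e⟩⟩ := hcl Q hQ hQi
  obtain ⟨i, hi⟩ := hP ω
  exact (isUniform_of_isSimpleModule ω.Rep).of_isEssentialEmbedding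
    ((isEssentialEmbedding_equiv e).comp hi)

/-- Over a CEP ring the indecomposable projective modules are roughly tight with respect to cyclic
modules. -/
theorem IsCEP.isRoughlyTight (h : IsCEP A) {Q : Type u} [AddCommGroup Q] [Module A Q]
    [hQ : Module.Projective A Q] (hQi : IsIndecomposable A Q) : IsRoughlyTight A A Q := by
  intro K hK E _ _ ι hι hemb
  obtain ⟨j, hj⟩ := hemb
  have hQu := h.isUniform hQi
  obtain ⟨P, hP, hcl⟩ := h.exists_simple_classification
  obtain ⟨ω, ⟨e⟩⟩ := hcl Q hQ hQi
  obtain ⟨i, hi⟩ := hP ω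
  have hE : IsUniform A E := hQu.of_isEssentialEmbedding hι.2
  obtain ⟨P', _, _, hP', k, hk⟩ := h (A ⧸ K) (isCyclicModule_quotient K)
  have : Nontrivial (A ⧸ K) := Submodule.Quotient.nontrivial_iff.2 hK
  have : Nontrivial P' := hk.1.nontrivial
  -- `A ⧸ K` lies in the uniform module `E`, so its essential extension `P'` is uniform and hence
  -- indecomposable.
  obtain ⟨ω', ⟨e'⟩⟩ := hcl P' hP'
    ((hE.of_injective hj).of_isEssentialEmbedding hk).isIndecomposable
  obtain ⟨i', hi'⟩ := hP ω'
  have hjne : LinearMap.range j ≠ ⊥ := by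
    rw [Ne, LinearMap.range_eq_bot]
    rintro rfl
    obtain ⟨x, hx⟩ := exists_ne (0 : A ⧸ K)
    exact hx (hj rfl)
  -- The simple submodule of `Q` lies in the image of `A ⧸ K` in `E` and so passes to `P'`. The two
  -- types agree, whence `P'` and `Q` are isomorphic.
  let u : ω.Rep →ₗ[A] E := ι ∘ₗ e.toLinearMap ∘ₗ i
  have hu : Function.Injective u := hι.2.1.comp (e.injective.comp hi.1)
  have hle := (hE _ hjne).range_le u
  let ej := LinearEquiv.ofInjective j hj
  let v : ω.Rep →ₗ[A] P' := k ∘ₗ ej.symm.toLinearMap ∘ₗ u.codRestrict _ fun x => hle ⟨x, rfl⟩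
  have hv : Function.Injective v := hk.1.comp (ej.symm.injective.comp fun x y hxy =>
    hu (congrArg Subtype.val hxy))
  have hle' := ((isEssentialEmbedding_equiv e').comp hi').2.range_le v
  have hω : ω ∈ ({ω'} : Set (SimpleClass A)) :=
    mem_of_range_le_socleOver hv (hle'.trans (range_le_socleOver (Set.mem_singleton ω') _))
  rw [Set.mem_singleton_iff] at hω
  subst hω
  exact ⟨_, (isEssentialEmbedding_equiv (e'.symm.trans e)).comp hk⟩

/-! ### The converse: artinian rings with uniform, tight indecomposable projectives. -/

/-- There are finitely many isomorphism classes of simple modules over an artinian ring. -/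
theorem finite_simpleClass_of_isArtinian [IsArtinianRing A] : Finite (SimpleClass A) := by
  classical
  obtain ⟨s, hs⟩ := Finset.exists_inf_le (SimpleClass.ideal (A := A))
  refine Set.finite_univ_iff.1 (s.finite_toSet.subset fun τ _ => ?_)
  let I : Submodule A A := s.inf SimpleClass.ideal
  let f : (A ⧸ I) →ₗ[A] ∀ ω : s, ω.1.Rep := I.liftQ (LinearMap.pi fun ω => ω.1.ideal.mkQ) (by
    intro a ha
    rw [LinearMap.mem_ker]
    ext ω
    simpa using Submodule.mem_finsetInf.1 ha ω.1 ω.2)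
  have hf : Function.Injective f := by
    rw [← LinearMap.ker_eq_bot]
    refine Submodule.ker_liftQ_eq_bot _ _ _ fun a ha => ?_
    refine Submodule.mem_finsetInf.2 fun ω hω => ?_
    simpa using congrFun (LinearMap.mem_ker.1 ha) ⟨ω, hω⟩
  -- The simple quotient `τ` of `A ⧸ I` extends to the finite product of simples, and a nonzero
  -- component identifies `τ` with a member of `s`.
  obtain ⟨h, hh⟩ := IsSemisimpleModule.extension_property f hf (Submodule.factor (hs τ))
  by_contra hτ
  have h0 : h = 0 := by
    refine LinearMap.pi_ext' fun ω => ?_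
    rw [LinearMap.zero_comp]
    by_contra hne
    exact hτ ((SimpleClass.eq_of_equiv
      (LinearEquiv.ofBijective _ (LinearMap.bijective_of_ne_zero hne))) ▸ ω.2)
  have : Nontrivial τ.Rep := IsSimpleModule.nontrivial A _
  obtain ⟨y, hy⟩ := exists_ne (0 : τ.Rep)
  obtain ⟨x, rfl⟩ := Submodule.factor_surjective (hs τ) y
  rw [← hh, h0] at hy
  exact hy rfl

/-- Over an artinian ring every simple module is a quotient of an indecomposable direct summand of
the ring. -/
theorem exists_indecomposable_summand [IsArtinianRing A] (m : Submodule A A) (hm : m ≠ ⊤) :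
    ∃ Q : Submodule A A, IsComplemented Q ∧ IsIndecomposable A Q ∧ ¬ Q ≤ m := by
  -- In any decomposition of a minimal such `Q`, some part is not inside `m`; being a summand of
  -- `A`, it is all of `Q`.
  obtain ⟨Q, ⟨⟨C, hC⟩, hQm⟩, hmin⟩ := WellFounded.has_min
    (wellFounded_lt (α := Submodule A A)) {Q | IsComplemented Q ∧ ¬ Q ≤ m}
    ⟨⊤, isComplemented_top, fun h => hm (top_le_iff.1 h)⟩
  have key : ∀ K L : Submodule A Q, IsCompl K L → ¬ K.map Q.subtype ≤ m → L = ⊥ := by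
    intro K L hKL hK
    have hdisj : Disjoint (K.map Q.subtype) (L.map Q.subtype) := by
      rw [disjoint_iff, ← Submodule.map_inf _ Q.injective_subtype, hKL.inf_eq_bot,
        Submodule.map_bot]
    have hsup : K.map Q.subtype ⊔ L.map Q.subtype = Q := by
      rw [← Submodule.map_sup, hKL.sup_eq_top, Submodule.map_subtype_top]
    have h1 : IsComplemented (K.map Q.subtype) :=
      ⟨_, hdisj.isCompl_sup_right_of_isCompl_sup_left (hsup.symm ▸ hC)⟩
    have h2 := hmin _ ⟨h1, hK⟩
    have h3 : K.map Q.subtype = Q := by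
      by_contra hne
      exact h2 (lt_of_le_of_ne (Submodule.map_subtype_le Q K) hne)
    have h4 : L.map Q.subtype = ⊥ := by
      rw [h3] at hdisj
      exact disjoint_self.1 (hdisj.mono_left (Submodule.map_subtype_le Q L))
    exact Submodule.map_injective_of_injective Q.injective_subtype
      (by rw [h4, Submodule.map_bot])
  refine ⟨Q, ⟨C, hC⟩, ⟨?_, fun K L hKL => ?_⟩, hQm⟩
  · rw [Submodule.nontrivial_iff_ne_bot]
    rintro rfl
    exact hQm bot_le
  · by_cases hK : K.map Q.subtype ≤ m
    · refine Or.inl (key L K hKL.symm fun hL => hQm ?_)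
      rw [← Submodule.map_subtype_top Q, ← hKL.sup_eq_top, Submodule.map_sup]
      exact sup_le hK hL
    · exact Or.inr (key K L hKL hK)

/-- A uniform artinian projective module has only one simple quotient. -/
theorem IsUniform.simple_quotient_unique {Q : Type u} [AddCommGroup Q] [Module A Q]
    [Module.Projective A Q] [IsArtinian A Q] (hQ : IsUniform A Q) {ω ω' : SimpleClass A}
    {p : Q →ₗ[A] ω.Rep} (hp : p ≠ 0) {p' : Q →ₗ[A] ω'.Rep} (hp' : p' ≠ 0) : ω = ω' := by
  have hps := LinearMap.surjective_of_ne_zero hp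
  have hps' := LinearMap.surjective_of_ne_zero hp'
  have hker : LinearMap.ker p' ≤ LinearMap.ker p := by
    by_contra hle
    have hne : p ∘ₗ (LinearMap.ker p').subtype ≠ 0 := fun h0 => hle fun x hx =>
      LinearMap.congr_fun h0 (⟨x, hx⟩ : LinearMap.ker p')
    obtain ⟨f, hf⟩ := Module.projective_lifting_property (p ∘ₗ (LinearMap.ker p').subtype) p
      (LinearMap.surjective_of_ne_zero hne)
    -- `F` induces the identity through `p` and zero through `p'`. By uniformity `F` or `id - F` is
    -- injective, hence surjective on an artinian module, which forces `p' = 0` or `p = 0`.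
    let F : Q →ₗ[A] Q := (LinearMap.ker p').subtype ∘ₗ f
    have hpF : ∀ x, p (F x) = p x := fun x => LinearMap.congr_fun hf x
    have hpF' : ∀ x, p' (F x) = 0 := fun x => LinearMap.mem_ker.1 (f x).2
    by_cases hF : LinearMap.ker F = (⊥ : Submodule A Q)
    · have := IsArtinian.surjective_of_injective_endomorphism F (LinearMap.ker_eq_bot.1 hF)
      refine hp' (LinearMap.ext fun y => ?_)
      obtain ⟨x, rfl⟩ := this y
      exact hpF' x
    · have hinj : Function.Injective ((LinearMap.id : Q →ₗ[A] Q) - F) := by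
        refine (hQ _ hF).injective ?_
        rw [eq_bot_iff]
        rintro x ⟨h1, h2⟩
        have h1' : F x = 0 := h1
        have h2' : x - F x = 0 := h2
        simpa [h1'] using h2'
      have := IsArtinian.surjective_of_injective_endomorphism _ hinj
      refine hp (LinearMap.ext fun y => ?_)
      obtain ⟨x, rfl⟩ := this y
      simp [hpF]
  have h1 := (LinearMap.isCoatom_ker_of_surjective hps').le_iff.1 hker
  have h2 : LinearMap.ker p = LinearMap.ker p' := h1.resolve_left fun h0 =>
    hp (LinearMap.ker_eq_top.1 h0)
  exact SimpleClass.eq_of_equiv (((p.quotKerEquivOfSurjective hps).symm.trans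
    (Submodule.quotEquivOfEq _ _ h2)).trans (p'.quotKerEquivOfSurjective hps'))

/-- A cyclic module with an essential submodule `D` embeds in every roughly tight module in which
`D` embeds. -/
theorem IsRoughlyTight.exists_injective {Q Q' D : Type u} [AddCommGroup Q] [Module A Q]
    [AddCommGroup Q'] [Module A Q'] [AddCommGroup D] [Module A D] [Nontrivial Q]
    (h : IsRoughlyTight A A Q') {r : A →ₗ[A] Q} (hr : Function.Surjective r) {i : D →ₗ[A] Q}
    (hi : IsEssentialEmbedding i) {j : D →ₗ[A] Q'} (hj : Function.Injective j) :
    ∃ f : Q →ₗ[A] Q', Function.Injective f := by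
  obtain ⟨E, _, _, ι, hι⟩ := exists_isInjectiveHull A Q'
  obtain ⟨φ, hφ⟩ := hι.1.out i hi.1 (ι ∘ₗ j)
  have hφi : Function.Injective φ := by
    refine hi.2.injective ?_
    rw [eq_bot_iff]
    rintro _ ⟨⟨d, rfl⟩, hd⟩
    have h1 : ι (j d) = 0 := by
      have := hφ d
      rw [LinearMap.mem_ker.1 hd] at this
      exact this.symm
    have : d = 0 := hj (hι.2.1 (by rw [h1, map_zero, map_zero]))
    simp [this]
  let e := r.quotKerEquivOfSurjective hr
  have hK : LinearMap.ker r ≠ ⊤ := by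
    rw [Ne, LinearMap.ker_eq_top]
    rintro rfl
    obtain ⟨x, hx⟩ := exists_ne (0 : Q)
    obtain ⟨a, ha⟩ := hr x
    exact hx (by rw [← ha, LinearMap.zero_apply])
  obtain ⟨g, hg⟩ := h _ hK E ι hι ⟨φ ∘ₗ e.toLinearMap, hφi.comp e.injective⟩
  exact ⟨g ∘ₗ e.symm.toLinearMap, hg.1.comp e.symm.injective⟩

theorem exists_simple_submodule (Q : Type u) [AddCommGroup Q] [Module A Q] [IsArtinian A Q]
    [Nontrivial Q] : ∃ (ω : SimpleClass A) (i : ω.Rep →ₗ[A] Q), Function.Injective i := by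
  obtain ⟨S, hS, -⟩ := (eq_bot_or_exists_atom_le (⊤ : Submodule A Q)).resolve_left top_ne_bot
  have := isSimpleModule_iff_isAtom.2 hS
  obtain ⟨ω, ⟨e⟩⟩ := exists_simpleClass (A := A) S
  exact ⟨ω, S.subtype ∘ₗ e.symm.toLinearMap, S.injective_subtype.comp e.symm.injective⟩

theorem IsUniform.isEssentialEmbedding {D Q : Type u} [AddCommGroup D] [Module A D]
    [AddCommGroup Q] [Module A Q] [Nontrivial D] (hQ : IsUniform A Q) {i : D →ₗ[A] Q}
    (hi : Function.Injective i) : IsEssentialEmbedding i := by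
  refine ⟨hi, hQ _ ?_⟩
  rw [Ne, LinearMap.range_eq_bot]
  rintro rfl
  obtain ⟨x, hx⟩ := exists_ne (0 : D)
  exact hx (hi rfl)

variable (A) in
/-- Every indecomposable projective module is uniform and roughly tight with respect to `A`. -/
def IndecomposableProjectivesTight : Prop :=
  ∀ (P : Type u) [AddCommGroup P] [Module A P], Module.Projective A P → IsIndecomposable A P →
    IsUniform A P ∧ IsRoughlyTight A A P

/-- Every simple module embeds in an indecomposable projective module. -/
theorem IndecomposableProjectivesTight.exists_injective [IsArtinianRing A]
    (H : IndecomposableProjectivesTight A) (ω : SimpleClass A) :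
    ∃ (Q : Type u) (_ : AddCommGroup Q) (_ : Module A Q) (i : ω.Rep →ₗ[A] Q),
      Module.Projective A Q ∧ IsIndecomposable A Q ∧ Function.Injective i := by
  have hcov : ∀ ω : SimpleClass A, ∃ (ω' : SimpleClass A) (Q : Submodule A A)
      (p : Q →ₗ[A] ω.Rep) (i : ω'.Rep →ₗ[A] Q) (r : A →ₗ[A] Q), Module.Projective A Q ∧
      IsIndecomposable A Q ∧ p ≠ 0 ∧ Function.Injective i ∧ Function.Surjective r := by
    intro ω
    obtain ⟨Q, ⟨C, hC⟩, hQ, hQω⟩ := exists_indecomposable_summand ω.ideal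
      (isSimpleModule_iff_isCoatom.1 (inferInstance : IsSimpleModule A ω.Rep)).1
    have := hQ.1
    obtain ⟨ω', i, hi⟩ := exists_simple_submodule (A := A) Q
    refine ⟨ω', Q, ω.ideal.mkQ ∘ₗ Q.subtype, i, Q.projectionOnto C hC,
      Module.Projective.of_split Q.subtype (Q.projectionOnto C hC)
        (LinearMap.ext fun x => Submodule.projectionOnto_apply_left hC x), hQ, ?_, hi,
      fun x => ⟨x, Submodule.projectionOnto_apply_left hC x⟩⟩
    intro h0
    refine hQω fun x hx => ?_
    have := LinearMap.congr_fun h0 ⟨x, hx⟩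
    simpa using this
  choose σ Q p i r hproj hind hp hi hr using hcov
  have hfin : Finite (SimpleClass A) := finite_simpleClass_of_isArtinian
  -- With a common simple submodule, tightness embeds `Q ω₁` and `Q ω₂` in each other, so they are
  -- isomorphic by the artinian condition. Their unique simple quotients then agree.
  have hσ : Function.Injective σ := by
    intro ω₁ ω₂ h12
    have hess : ∀ ω, IsEssentialEmbedding (i ω) := fun ω =>
      have : Nontrivial (σ ω).Rep := IsSimpleModule.nontrivial A _
      (H (Q ω) (hproj ω) (hind ω)).1.isEssentialEmbedding (hi ω)
    have emb : ∀ ω ω', σ ω = σ ω' → ∃ f : Q ω →ₗ[A] Q ω', Function.Injective f := by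
      intro ω ω' hωω'
      have := (hind ω).1
      obtain ⟨j, hj⟩ : ∃ j : (σ ω).Rep →ₗ[A] Q ω', Function.Injective j := by
        rw [hωω']
        exact ⟨i ω', hi ω'⟩
      exact (H (Q ω') (hproj ω') (hind ω')).2.exists_injective (hr ω) (hess ω) hj
    obtain ⟨f, hf⟩ := emb ω₁ ω₂ h12
    obtain ⟨g, hg⟩ := emb ω₂ ω₁ h12.symm
    have hfg := IsArtinian.surjective_of_injective_endomorphism (f ∘ₗ g) (hf.comp hg)
    have hfs : Function.Surjective f := Function.Surjective.of_comp (g := g) hfg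
    have := hproj ω₁
    refine (H (Q ω₁) (hproj ω₁) (hind ω₁)).1.simple_quotient_unique (hp ω₁)
      (p' := p ω₂ ∘ₗ f) fun h0 => hp ω₂ (LinearMap.ext fun y => ?_)
    obtain ⟨x, rfl⟩ := hfs y
    exact LinearMap.congr_fun h0 x
  obtain ⟨ω, rfl⟩ := Finite.injective_iff_surjective.1 hσ ω
  exact ⟨Q ω, _, _, i ω, hproj ω, hind ω, hi ω⟩

/-- Elements of a cyclic module are separated by quotients which essentially embed in uniform
projective modules. -/
theorem IndecomposableProjectivesTight.exists_separating [IsArtinianRing A]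
    (H : IndecomposableProjectivesTight A) {K : Submodule A A} {a : A} (ha : a ∉ K) :
    ∃ L : Submodule A A, K ≤ L ∧ a ∉ L ∧ ∃ (P : Type u) (_ : AddCommGroup P) (_ : Module A P),
      Module.Projective A P ∧ IsUniform A P ∧ EssentiallyEmbeds A (A ⧸ L) P := by
  let X : Submodule A (A ⧸ K) := Submodule.span A {K.mkQ a}
  have hx : K.mkQ a ∈ X := Submodule.mem_span_singleton_self _
  have hX : Nontrivial X := ⟨⟨⟨K.mkQ a, hx⟩, 0, fun h0 => ha (by
    simpa using congrArg Subtype.val h0)⟩⟩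
  obtain ⟨M, hM, -⟩ := (eq_top_or_exists_le_coatom (⊥ : Submodule A X)).resolve_left bot_ne_top
  have := isSimpleModule_iff_isCoatom.2 hM
  obtain ⟨ω, ⟨e⟩⟩ := exists_simpleClass (A := A) (X ⧸ M)
  obtain ⟨P, _, _, i, hP, hPi, hi⟩ := H.exists_injective ω
  obtain ⟨E, _, _, ι, hι⟩ := exists_isInjectiveHull A P
  -- `g` does not kill the class of `a`, and injectivity of `E` extends it to `A ⧸ K`. The kernel
  -- `L` of the extension separates `a`, and tightness moves `A ⧸ L` from `E` into `P`.
  let g : X →ₗ[A] E := ι ∘ₗ i ∘ₗ e.toLinearMap ∘ₗ M.mkQ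
  obtain ⟨φ, hφ⟩ := hι.1.out X.subtype X.injective_subtype g
  let L := LinearMap.ker (φ ∘ₗ K.mkQ)
  have haL : a ∉ L := by
    intro h0
    refine hM.1 (eq_top_iff.2 fun y _ => ?_)
    obtain ⟨b, hb⟩ := Submodule.mem_span_singleton.1 y.2
    have h1 : g ⟨K.mkQ a, hx⟩ = 0 := by
      rw [← hφ]
      exact h0
    have h2 : y = b • ⟨K.mkQ a, hx⟩ := Subtype.ext hb.symm
    have h3 : g y = 0 := by rw [h2, map_smul, h1, smul_zero]
    have h4 : M.mkQ y = 0 := e.injective (hi (hι.2.1 (by simpa [g] using h3)))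
    simpa using h4
  refine ⟨L, fun x hx => ?_, haL, P, _, _, hP, (H P hP hPi).1,
    (H P hP hPi).2 L (fun h => haL (h ▸ Submodule.mem_top)) E ι hι
      ⟨L.liftQ (φ ∘ₗ K.mkQ) le_rfl, LinearMap.ker_eq_bot.1 (Submodule.ker_liftQ_eq_bot _ _ _ le_rfl)⟩⟩
  have : K.mkQ x = 0 := by simpa using hx
  rw [LinearMap.mem_ker, LinearMap.comp_apply, this, map_zero]

/-- A submodule of a finite product of uniform modules is essential if it meets every factor. -/
theorem isEssential_pi {ι : Type u} [Finite ι] [DecidableEq ι] {P : ι → Type u}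
    [∀ i, AddCommGroup (P i)] [∀ i, Module A (P i)] (hP : ∀ i, IsUniform A (P i))
    {S : Submodule A (∀ i, P i)} (hS : ∀ i, ∃ x : P i, x ≠ 0 ∧ Pi.single i x ∈ S) :
    IsEssential S := by
  have := Fintype.ofFinite ι
  have hess : ∀ i, IsEssential (S.comap (LinearMap.single A P i)) := fun i => by
    obtain ⟨x, hx, hxS⟩ := hS i
    exact hP i _ (Submodule.ne_bot_iff _ |>.2 ⟨x, hxS, hx⟩)
  refine (IsEssential.finset_inf Finset.univ fun i _ =>
    (hess i).comap (LinearMap.proj (φ := P) i)).mono fun y hy => ?_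
  rw [← Finset.univ_sum_single y]
  refine Submodule.sum_mem _ fun i hi => ?_
  exact Submodule.mem_finsetInf.1 hy i hi

/-- An artinian ring whose indecomposable projective modules are uniform and roughly tight is
CEP. -/
theorem IndecomposableProjectivesTight.isCEP [IsArtinianRing A]
    (H : IndecomposableProjectivesTight A) : IsCEP A := by
  classical
  rintro N _ _ ⟨x, hx⟩
  let r := LinearMap.toSpanSingleton A N x
  have hr : Function.Surjective r := by
    rw [← LinearMap.range_eq_top, LinearMap.range_toSpanSingleton, hx]
  let K := LinearMap.ker r
  let I : Type u := {L : Submodule A A // K ≤ L ∧ ∃ P : ModuleCat.{u} A,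
      Module.Projective A P ∧ IsUniform A P ∧ EssentiallyEmbeds A (A ⧸ L) P}
  obtain ⟨s, hs⟩ := Finset.exists_inf_le (fun L : I => L.1)
  have hsK : s.inf (fun L : I => L.1) ≤ K := by
    intro a ha
    by_contra haK
    obtain ⟨L, hKL, haL, P, _, _, hP⟩ := H.exists_separating haK
    exact haL (hs ⟨L, hKL, ModuleCat.of A P, hP⟩ ha)
  obtain ⟨t, htK, htmin⟩ := WellFounded.has_min (wellFounded_lt (α := Finset I))
    {t | t.inf (fun L : I => L.1) ≤ K} ⟨s, hsK⟩
  choose P hPproj hPuni h hh using fun L : I => L.2.2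
  let φ : A →ₗ[A] ∀ L : t, P L.1 := LinearMap.pi fun L => h L.1 ∘ₗ L.1.1.mkQ
  have hφ0 : ∀ (a : A) (L : t), φ a L = 0 ↔ a ∈ L.1.1 := fun a L => by
    change h L.1 (L.1.1.mkQ a) = 0 ↔ _
    rw [map_eq_zero_iff _ (hh L.1).1]
    simp
  have hker : LinearMap.ker φ = K := by
    apply le_antisymm
    · intro a ha
      refine htK (Submodule.mem_finsetInf.2 fun L hL => (hφ0 a ⟨L, hL⟩).1 ?_)
      exact congrFun (LinearMap.mem_ker.1 ha) _
    · intro a ha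
      rw [LinearMap.mem_ker]
      ext L
      exact (hφ0 a L).2 (L.1.2.1 ha)
  let e := r.quotKerEquivOfSurjective hr
  let ψ : N →ₗ[A] ∀ L : t, P L.1 := K.liftQ φ hker.ge ∘ₗ e.symm.toLinearMap
  have hproj : Module.Projective A (∀ L : t, P L.1) :=
    have := fun L => hPproj L
    Module.Projective.of_equiv' (DFinsupp.linearEquivFunOnFintype (R := A))
  refine ⟨∀ L : t, P L.1, _, _, hproj, ψ, ?_, ?_⟩
  · exact (LinearMap.ker_eq_bot.1 (Submodule.ker_liftQ_eq_bot K φ hker.ge hker.le)).comp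
      e.symm.injective
  · have hrange : LinearMap.range φ ≤ LinearMap.range ψ := by
      rw [LinearMap.range_comp, LinearEquiv.range, ← LinearMap.range_eq_map, Submodule.range_liftQ]
    refine (isEssential_pi (fun L => hPuni L.1) fun L => ?_).mono hrange
    -- By minimality of `t`, some `a ∉ K` lies in all the other members. Its image is then
    -- concentrated in the factor at `L` and is nonzero there.
    have hL : ¬ (t.erase L.1).inf (fun L : I => L.1) ≤ K := fun hle =>
      htmin _ hle (Finset.erase_ssubset L.2)
    obtain ⟨a, ha, haK⟩ := Set.not_subset.1 hL
    have haL : ∀ L' : t, L' ≠ L → φ a L' = 0 := fun L' hL' => (hφ0 a L').2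
      (Submodule.mem_finsetInf.1 ha L'.1 (Finset.mem_erase.2 ⟨fun h => hL' (Subtype.ext h), L'.2⟩))
    have hsingle : Pi.single L (φ a L) = φ a := by
      ext L'
      by_cases hL' : L' = L
      · subst hL'
        simp
      · rw [Pi.single_eq_of_ne hL', haL L' hL']
    refine ⟨φ a L, fun h0 => haK ?_, ⟨a, hsingle.symm⟩⟩
    rw [← hker]
    exact LinearMap.mem_ker.2 (by rw [← hsingle, h0, Pi.single_zero])

/-! ### Passage between `R` as a right module and the left regular module of `Rᵐᵒᵖ`. -/

theorem IsRoughlyTight.congr {N N' M : Type u} [AddCommGroup N] [Module A N]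
    [AddCommGroup N'] [Module A N'] [AddCommGroup M] [Module A M] (e : N ≃ₗ[A] N')
    (h : IsRoughlyTight A N M) : IsRoughlyTight A N' M := by
  intro K hK E _ _ ι hι ⟨f, hf⟩
  have hmap : (K.comap e.toLinearMap).map e.toLinearMap = K :=
    Submodule.map_comap_eq_of_surjective e.surjective K
  let q : (N ⧸ K.comap e.toLinearMap) ≃ₗ[A] (N' ⧸ K) := Submodule.Quotient.equiv _ _ e hmap
  have hK' : K.comap e.toLinearMap ≠ ⊤ := fun h0 => hK (by
    rw [← hmap, h0, Submodule.map_top, LinearEquiv.range])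
  obtain ⟨g, hg⟩ := h _ hK' E ι hι ⟨f ∘ₗ q.toLinearMap, hf.comp q.injective⟩
  exact ⟨g ∘ₗ q.symm.toLinearMap, hg.comp (isEssentialEmbedding_equiv q.symm)⟩

/-- A ring as a right module over itself is the left regular module of its opposite. -/
def opEquiv (R : Type u) [Ring R] : R ≃ₗ[Rᵐᵒᵖ] Rᵐᵒᵖ where
  toFun := MulOpposite.op
  invFun := MulOpposite.unop
  map_add' _ _ := rfl
  map_smul' _ _ := rfl
  left_inv _ := rfl
  right_inv _ := rfl

end EssMod

theorem theorem4p22 (R : Type u) [Ring R] :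
    EssMod.IsCEPRing R ↔
      (IsArtinian Rᵐᵒᵖ R ∧
        ∀ (P : Type u) [AddCommGroup P] [Module Rᵐᵒᵖ P],
          Module.Projective Rᵐᵒᵖ P → EssMod.IsIndecomposable Rᵐᵒᵖ P →
            EssMod.IsUniform Rᵐᵒᵖ P ∧ EssMod.IsRoughlyTight Rᵐᵒᵖ R P) := by
  have e := EssMod.opEquiv R
  constructor
  · intro h
    have hA : EssMod.IsCEP Rᵐᵒᵖ := h
    have hart := hA.isArtinian
    exact ⟨isArtinian_of_linearEquiv e.symm, fun P _ _ _ hP =>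
      ⟨hA.isUniform hP, (hA.isRoughlyTight hP).congr e.symm⟩⟩
  · rintro ⟨hart, H⟩
    have : IsArtinianRing Rᵐᵒᵖ := isArtinian_of_linearEquiv e
    have H' : EssMod.IndecomposableProjectivesTight Rᵐᵒᵖ := fun P _ _ hP hPi =>
      ⟨(H P hP hPi).1, (H P hP hPi).2.congr e⟩
    exact H'.isCEP
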